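/- Let $0<q<1$. For complex $x$ put $(x;q)_n=\prod_{k=0}^{n-1}(1-xq^k)$ for integers $n\ge 0$ and $(x;q)_\infty=\prod_{k=0}^{\infty}(1-xq^k)$, write $(x_1,\dots,x_m;q)_n=(x_1;q)_n\cdots(x_m;q)_n$ (also for $n=\infty$), and let $$ {}_4\phi_3\left({a_1,a_2,a_3,a_4\atop b_1,b_2,b_3};q,x\right)=\sum_{n=0}^\infty\frac{(a_1,a_2,a_3,a_4;q)_n}{(q,b_1,b_2,b_3;q)_n}\,x^n . $$ Let $\alpha,a,b,z,\beta,\gamma,c,d,h$ be complex numbers such that no denominator below vanishes, that is, $\alpha\ne 1$, $a\neq 0$, $b\ne 0$, and none of $\alpha a,\ \alpha b,\ c,\ d,\ h$ is of the form $q^{-n}$ with an integer $n\ge 0$. If $|\alpha abz/q|<1$, then $$ \frac{(\alpha q,\alpha ab/q;q)_\infty}{(\alpha a,\alpha b;q)_\infty}\; {}_4\phi_3\left({q/a,\,q/b,\,\beta,\,\gamma\atop c,\,d,\,h};q,\frac{\alpha abz}{q}\right) =\sum_{n=0}^\infty\frac{(1-\alpha q^{2n})(\alpha,q/a,q/b;q)_n(-\alpha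 ab/q)^n q^{n(n-1)/2}}{(1-\alpha)(q,\alpha a,\alpha b;q)_n}\; {}_4\phi_3\left({q^{-n},\,\alpha q^n,\,\beta,\,\gamma\atop c,\,d,\,h};q,qz\right), $$ where the series ${}_4\phi_3$ on the left and the series over $n$ on the right converge absolutely (each ${}_4\phi_3$ on the right is a finite sum, since $(q^{-n};q)_k=0$ for $k>n$). -/

import Mathlib

/-- The `q`-shifted factorial `(a; q)_n = ∏_{k=0}^{n-1} (1 - a q^k)`. -/
noncomputable def qShiftedFactorial (a q : ℂ) (n : ℕ) : ℂ :=
  ∏ k ∈ Finset.range n, (1 - a * q ^ k)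

/-- The infinite `q`-shifted factorial `(a; q)_∞ = ∏_{k=0}^∞ (1 - a q^k)`. -/
noncomputable def qShiftedFactorialInf (a q : ℂ) : ℂ :=
  ∏' k : ℕ, (1 - a * q ^ k)

/-- For `|q| < 1` the product defining `(a; q)_∞` converges. -/
theorem multipliable_qShiftedFactorialInf (a q : ℂ) (hq : ‖q‖ < 1) :
    Multipliable (fun k : ℕ => 1 - a * q ^ k) := by
  have hs : Summable (fun k : ℕ => ‖-(a * q ^ k)‖) := by
    simp only [norm_neg, norm_mul, norm_pow]
    exact (summable_geometric_of_lt_one (norm_nonneg q) hq).mul_left _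
  simpa [sub_eq_add_neg] using multipliable_one_add_of_summable hs

/-- The compact notation `(a_1, ..., a_m; q)_n = (a_1; q)_n ⋯ (a_m; q)_n`. -/
noncomputable def qShiftedFactorials (as : List ℂ) (q : ℂ) (n : ℕ) : ℂ :=
  (as.map fun a => qShiftedFactorial a q n).prod

/-- The compact notation `(a_1, ..., a_m; q)_∞ = (a_1; q)_∞ ⋯ (a_m; q)_∞`. -/
noncomputable def qShiftedFactorialsInf (as : List ℂ) (q : ℂ) : ℂ :=
  (as.map fun a => qShiftedFactorialInf a q).prod

/-- The `n`-th term of the basic hypergeometric series `_rφ_s(as; bs; q, z)`, where `r` and `s` are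
the lengths of the lists `as` and `bs`. -/
noncomputable def basicHypergeometricTerm (as bs : List ℂ) (q z : ℂ) (n : ℕ) : ℂ :=
  qShiftedFactorials as q n / qShiftedFactorials (q :: bs) q n *
    ((-1) ^ n * q ^ (n * (n - 1) / 2)) ^ (1 + (bs.length : ℤ) - (as.length : ℤ)) * z ^ n

/-- The basic hypergeometric series `_rφ_s(as; bs; q, z)`. -/
noncomputable def basicHypergeometric (as bs : List ℂ) (q z : ℂ) : ℂ :=
  ∑' n : ℕ, basicHypergeometricTerm as bs q z n

/-! Expand each terminating series on the right, put n = k + m, and sum over m first for fixed k.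
Since (α;q)_n (αq^n;q)_k = (α;q)_{2k} (αq^{2k};q)_m, the inner sum is a limiting very-well-poised
`₆φ₅` with A = αq^{2k}, u = a/q^k, v = b/q^k (`expansionCoeff_mul_term`). Its closed form turns the
k-th row into the k-th term on the left times the infinite products. The interchange is legitimate
because the double series is dominated by a geometric series in k times a q-Gaussian series in m.

The `₆φ₅` sum S(A) is found by creative telescoping: a rational certificate relates S(A) to S(Aq).
Iterating gives finite products times S(Aq^N), and S(Aq^N) tends to S(0) = 1 by dominated
convergence. -/

open Filter Topology Finset

/-! ### q-shifted factorials: shifts, limits and uniform bounds. -/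

section QShiftedFactorial

variable {q : ℂ}

theorem qShiftedFactorial_zero (x q : ℂ) : qShiftedFactorial x q 0 = 1 := by
  simp [qShiftedFactorial]

theorem qShiftedFactorial_succ (x q : ℂ) (n : ℕ) :
    qShiftedFactorial x q (n + 1) = qShiftedFactorial x q n * (1 - x * q ^ n) :=
  prod_range_succ _ _

theorem qShiftedFactorial_add (x q : ℂ) (m n : ℕ) :
    qShiftedFactorial x q (m + n) =
      qShiftedFactorial x q m * qShiftedFactorial (x * q ^ m) q n := by
  simp only [qShiftedFactorial, prod_range_add, pow_add, mul_assoc]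

theorem qShiftedFactorial_succ' (x q : ℂ) (n : ℕ) :
    qShiftedFactorial x q (n + 1) = (1 - x) * qShiftedFactorial (x * q) q n := by
  rw [add_comm, qShiftedFactorial_add]
  simp [qShiftedFactorial]

theorem qShiftedFactorial_ne_zero {x : ℂ} (hx : ∀ n : ℕ, x * q ^ n ≠ 1) (n : ℕ) :
    qShiftedFactorial x q n ≠ 0 :=
  prod_ne_zero_iff.2 fun k _ => sub_ne_zero.2 (hx k).symm

theorem self_mul_pow_ne_one (hq : ‖q‖ < 1) (n : ℕ) : q * q ^ n ≠ 1 := by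
  intro h
  have h1 : ‖q‖ ^ (n + 1) = 1 := by rw [← norm_pow, pow_succ', h, norm_one]
  exact absurd h1 (pow_lt_one₀ (norm_nonneg q) hq n.succ_ne_zero).ne

theorem tendsto_qShiftedFactorial (x : ℂ) (hq : ‖q‖ < 1) :
    Tendsto (qShiftedFactorial x q) atTop (𝓝 (qShiftedFactorialInf x q)) :=
  (multipliable_qShiftedFactorialInf x q hq).hasProd.tendsto_prod_nat

theorem qShiftedFactorialInf_ne_zero {x : ℂ} (hq : ‖q‖ < 1) (hx : ∀ n : ℕ, x * q ^ n ≠ 1) :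
    qShiftedFactorialInf x q ≠ 0 := by
  have h := tprod_one_add_ne_zero_of_summable (f := fun k : ℕ => -(x * q ^ k))
    (fun k => by simpa [← sub_eq_add_neg] using sub_ne_zero.2 (hx k).symm) (by
      simp only [norm_neg, norm_mul, norm_pow]
      exact (summable_geometric_of_lt_one (norm_nonneg q) hq).mul_left _)
  simpa [qShiftedFactorialInf, sub_eq_add_neg] using h

theorem qShiftedFactorialInf_eq_mul (x : ℂ) (hq : ‖q‖ < 1) (n : ℕ) :
    qShiftedFactorialInf x q =
      qShiftedFactorial x q n * qShiftedFactorialInf (x * q ^ n) q := by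
  have h1 := (tendsto_qShiftedFactorial (x * q ^ n) hq).const_mul (qShiftedFactorial x q n)
  have h2 := (tendsto_qShiftedFactorial x hq).comp (tendsto_add_atTop_nat n)
  refine tendsto_nhds_unique h2 (h1.congr fun m => ?_)
  rw [← qShiftedFactorial_add, Function.comp_apply, add_comm]

/-- `(x; q)_n` is bounded uniformly in `n` and in `x` from a bounded set. -/
theorem exists_norm_qShiftedFactorial_le (hq : ‖q‖ < 1) (R : ℝ) :
    ∃ C : ℝ, 0 < C ∧ ∀ x : ℂ, ‖x‖ ≤ R → ∀ n, ‖qShiftedFactorial x q n‖ ≤ C := by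
  refine ⟨Real.exp (R * (1 - ‖q‖)⁻¹), Real.exp_pos _, fun x hx n => ?_⟩
  have hR : 0 ≤ R := (norm_nonneg x).trans hx
  rw [qShiftedFactorial, norm_prod]
  calc ∏ k ∈ range n, ‖1 - x * q ^ k‖ ≤ ∏ k ∈ range n, Real.exp (R * ‖q‖ ^ k) := by
        refine prod_le_prod (fun _ _ => norm_nonneg _) fun k _ => ?_
        calc ‖1 - x * q ^ k‖ ≤ ‖(1 : ℂ)‖ + ‖x * q ^ k‖ := norm_sub_le _ _
          _ ≤ R * ‖q‖ ^ k + 1 := by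
            rw [norm_one, norm_mul, norm_pow, add_comm]
            gcongr
          _ ≤ _ := Real.add_one_le_exp _
    _ = Real.exp (R * ∑ k ∈ range n, ‖q‖ ^ k) := by rw [← Real.exp_sum, mul_sum]
    _ ≤ _ := by
        gcongr
        rw [← tsum_geometric_of_lt_one (norm_nonneg q) hq]
        exact (summable_geometric_of_lt_one (norm_nonneg q) hq).sum_le_tsum _
          fun _ _ => by positivity

/-- The infinite product is nonzero, so the reciprocals converge and are therefore bounded. -/
theorem exists_norm_inv_qShiftedFactorial_le {x : ℂ} (hq : ‖q‖ < 1)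
    (hx : ∀ n : ℕ, x * q ^ n ≠ 1) :
    ∃ C : ℝ, 0 < C ∧ ∀ n, ‖(qShiftedFactorial x q n)⁻¹‖ ≤ C := by
  have h := Metric.isBounded_range_of_tendsto _
    ((tendsto_qShiftedFactorial x hq).inv₀ (qShiftedFactorialInf_ne_zero hq hx))
  obtain ⟨C, hC, h⟩ := h.exists_pos_norm_le
  exact ⟨C, hC, fun n => h _ ⟨n, rfl⟩⟩

/-- `(x q^N; q)_n` is bounded away from zero uniformly in `N` and `n`. -/
theorem exists_norm_inv_qShiftedFactorial_shift_le {x : ℂ} (hq : ‖q‖ < 1)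
    (hx : ∀ n : ℕ, x * q ^ n ≠ 1) :
    ∃ C : ℝ, 0 < C ∧ ∀ N n, ‖(qShiftedFactorial (x * q ^ N) q n)⁻¹‖ ≤ C := by
  obtain ⟨C, hC, h⟩ := exists_norm_inv_qShiftedFactorial_le hq hx
  obtain ⟨D, hD, h'⟩ := exists_norm_qShiftedFactorial_le hq ‖x‖
  refine ⟨D * C, by positivity, fun N n => ?_⟩
  have h0 := qShiftedFactorial_ne_zero hx N
  have : (qShiftedFactorial (x * q ^ N) q n)⁻¹ =
      qShiftedFactorial x q N * (qShiftedFactorial x q (N + n))⁻¹ := by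
    rw [qShiftedFactorial_add, mul_inv, mul_inv_cancel_left₀ h0]
  rw [this, norm_mul]
  exact mul_le_mul (h' x le_rfl N) (h _) (norm_nonneg _) hD.le

/-- The ratio of consecutive terms is s r^m, which tends to 0 however large s is. -/
theorem summable_pow_mul_pow_triangle {r : ℝ} (hr0 : 0 ≤ r) (hr1 : r < 1) (s : ℝ) :
    Summable fun m : ℕ => s ^ m * r ^ (m * (m - 1) / 2) := by
  refine summable_of_ratio_norm_eventually_le (r := 1 / 2) (by norm_num) ?_
  have h : Tendsto (fun m : ℕ => |s| * r ^ m) atTop (𝓝 0) := by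
    simpa using (tendsto_pow_atTop_nhds_zero_of_lt_one hr0 hr1).const_mul |s|
  filter_upwards [h.eventually_le_const (by norm_num : (0 : ℝ) < 1 / 2)] with m hm
  rw [Nat.triangle_succ, pow_succ, pow_add]
  calc ‖s ^ m * s * (r ^ (m * (m - 1) / 2) * r ^ m)‖
      = (|s| * r ^ m) * ‖s ^ m * r ^ (m * (m - 1) / 2)‖ := by
        simp only [norm_mul, norm_pow, Real.norm_eq_abs, abs_of_nonneg hr0]; ring
    _ ≤ _ := by gcongr

/-- `(q^{-n}; q)_k = (-1)^k q^{k(k-1)/2 - nk} (q; q)_n / (q; q)_{n-k}`, with `n = k + m`. -/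
theorem qShiftedFactorial_neg_pow (hq : ‖q‖ < 1) (hq0 : q ≠ 0) (k m : ℕ) :
    qShiftedFactorial (q ^ (-((k + m : ℕ) : ℤ))) q k * q ^ ((k + m) * k) =
      (-1) ^ k * q ^ (k * (k - 1) / 2) *
        (qShiftedFactorial q q (k + m) / qShiftedFactorial q q m) := by
  have h (j : ℕ) := qShiftedFactorial_ne_zero (self_mul_pow_ne_one hq) j
  induction k generalizing m with
  | zero => simp [qShiftedFactorial_zero, h m]
  | succ k ih =>
    -- Raising k while lowering m keeps n = k + m fixed, so only one new factor 1 - q^{k-n} appears.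
    have ih' := ih (m + 1)
    rw [show k + (m + 1) = k + 1 + m by ring] at ih'
    rw [qShiftedFactorial_succ, Nat.triangle_succ]
    have e : (1 - q ^ (-((k + 1 + m : ℕ) : ℤ)) * q ^ k) * q ^ (k + 1 + m)
        = -q ^ k * (1 - q * q ^ m) := by
      rw [zpow_neg, zpow_natCast]
      field_simp
      ring
    have h1 := sub_ne_zero.2 (self_mul_pow_ne_one hq m).symm
    have h2 := h m
    calc _ = (qShiftedFactorial (q ^ (-((k + 1 + m : ℕ) : ℤ))) q k * q ^ ((k + 1 + m) * k)) *
          ((1 - q ^ (-((k + 1 + m : ℕ) : ℤ)) * q ^ k) * q ^ (k + 1 + m)) := by ring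
      _ = _ := by
        rw [e, ih', qShiftedFactorial_succ q q m]
        field_simp
        ring

end QShiftedFactorial

/-! ### The limiting very-well-poised `₆φ₅` summation. -/

section VeryWellPoised

variable {q : ℂ}

/-- The terms of the limiting case `D → ∞` of the very-well-poised series `₆φ₅` with
parameters `A, B = q / u, C = q / v, D`, multiplied by `1 - A`. -/
noncomputable def veryWellPoisedTerm (q A u v : ℂ) (m : ℕ) : ℂ :=
  (1 - A * q ^ (2 * m)) * qShiftedFactorial A q m * qShiftedFactorial (q / u) q m
      * qShiftedFactorial (q / v) q m * (-(A * u * v / q)) ^ m * q ^ (m * (m - 1) / 2)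
    / (qShiftedFactorial q q m * qShiftedFactorial (A * u) q m * qShiftedFactorial (A * v) q m)

/-- The telescoping certificate for the contiguous relation between the series with parameters
`A` and `A q`. -/
noncomputable def veryWellPoisedCertificate (q A u v : ℂ) (m : ℕ) : ℂ :=
  -((1 - q ^ m) * qShiftedFactorial A q m * qShiftedFactorial (q / u) q m
      * qShiftedFactorial (q / v) q m * (-(A * u * v / q)) ^ m * q ^ (m * (m - 1) / 2))
    / (qShiftedFactorial q q m * qShiftedFactorial (A * u) q m * qShiftedFactorial (A * v) q m)

theorem mul_pow_ne_one_shift {x : ℂ} (hx : ∀ n : ℕ, x * q ^ n ≠ 1) (N n : ℕ) :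
    x * q ^ N * q ^ n ≠ 1 := by
  rw [mul_assoc, ← pow_add]; exact hx _

theorem one_sub_ne_zero_of_shift {x : ℂ} (hx : ∀ n : ℕ, x * q ^ n ≠ 1) : 1 - x ≠ 0 :=
  sub_ne_zero.2 fun h => hx 0 (by simp [← h])

/-- Up to common factors, this is a rational identity in X = q^m, A, u, v and q. -/
theorem veryWellPoisedTerm_sub (hq0 : q ≠ 0) (hq : ‖q‖ < 1) {A u v : ℂ} (hu : u ≠ 0)
    (hv : v ≠ 0) (hAu : ∀ n : ℕ, A * u * q ^ n ≠ 1) (hAv : ∀ n : ℕ, A * v * q ^ n ≠ 1) (m : ℕ) :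
    veryWellPoisedTerm q A u v m - (1 - A) * (1 - A * u * v / q) / ((1 - A * u) * (1 - A * v))
        * veryWellPoisedTerm q (A * q) u v m =
      veryWellPoisedCertificate q A u v (m + 1) - veryWellPoisedCertificate q A u v m := by
  have hu0 := one_sub_ne_zero_of_shift hAu
  have hv0 := one_sub_ne_zero_of_shift hAv
  have hum := sub_ne_zero.2 (hAu m).symm
  have hvm := sub_ne_zero.2 (hAv m).symm
  have hqm := sub_ne_zero.2 (self_mul_pow_ne_one hq m).symm
  have h1 := qShiftedFactorial_ne_zero (self_mul_pow_ne_one hq) m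
  have h2 := qShiftedFactorial_ne_zero hAu m
  have h3 := qShiftedFactorial_ne_zero hAv m
  -- Kept free of division by 1 - A, which may vanish: A = αq^{2k} can equal 1 even though α ≠ 1.
  have sA : (1 - A) * qShiftedFactorial (A * q) q m =
      qShiftedFactorial A q m * (1 - A * q ^ m) := by
    rw [← qShiftedFactorial_succ', qShiftedFactorial_succ]
  have shift (x : ℂ) (hx : 1 - x ≠ 0) : qShiftedFactorial (x * q) q m =
      qShiftedFactorial x q m * (1 - x * q ^ m) / (1 - x) := by
    rw [eq_div_iff hx, mul_comm, ← qShiftedFactorial_succ', qShiftedFactorial_succ]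
  have e1 : (1 - A) * (1 - A * u * v / q) / ((1 - A * u) * (1 - A * v))
        * veryWellPoisedTerm q (A * q) u v m =
      (1 - A * u * v / q) * (1 - A * q * (q ^ m) ^ 2)
        * (qShiftedFactorial A q m * (1 - A * q ^ m)) * qShiftedFactorial (q / u) q m
        * qShiftedFactorial (q / v) q m * (-(A * u * v / q)) ^ m * q ^ m * q ^ (m * (m - 1) / 2)
        / (qShiftedFactorial q q m * (qShiftedFactorial (A * u) q m * (1 - A * u * q ^ m))
          * (qShiftedFactorial (A * v) q m * (1 - A * v * q ^ m))) := by
    rw [veryWellPoisedTerm, ← sA, show A * q * u = A * u * q by ring,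
      show A * q * v = A * v * q by ring, shift _ hu0, shift _ hv0,
      show -(A * u * q * v / q) = -(A * u * v / q) * q by ring, mul_pow,
      show q ^ (2 * m) = (q ^ m) ^ 2 by ring]
    field_simp
  rw [e1, veryWellPoisedTerm, veryWellPoisedCertificate, veryWellPoisedCertificate,
    Nat.triangle_succ, pow_add q _ m, pow_succ (-(A * u * v / q)),
    show q ^ (2 * m) = (q ^ m) ^ 2 by ring, show q ^ (m + 1) = q * q ^ m by ring]
  simp only [qShiftedFactorial_succ]
  generalize qShiftedFactorial A q m = PA
  generalize qShiftedFactorial (q / u) q m = Pu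
  generalize qShiftedFactorial (q / v) q m = Pv
  generalize (-(A * u * v / q)) ^ m = Y
  generalize q ^ (m * (m - 1) / 2) = T
  generalize qShiftedFactorial q q m = Q1 at *
  generalize qShiftedFactorial (A * u) q m = Q2 at *
  generalize qShiftedFactorial (A * v) q m = Q3 at *
  generalize q ^ m = X at *
  clear sA shift e1
  generalize hE1 : 1 - q * X = E1 at *
  generalize hE2 : 1 - A * u * X = E2 at *
  generalize hE3 : 1 - A * v * X = E3 at *
  field_simp
  rw [← hE2, ← hE3]
  ring

/-- The substitution sends Au, Av to Auq^{N+j}, Avq^{N+j}, sends q/u, q/v to their multiples by q^j,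
and Auv to Auvq^N, so one constant serves all N and j. The case j = 0 dominates the limit N → ∞; the
case N = 0, j = k dominates the double series. -/
theorem exists_norm_veryWellPoised_le (hq0 : q ≠ 0) (hq : ‖q‖ < 1) {A u v : ℂ}
    (hAu : ∀ n : ℕ, A * u * q ^ n ≠ 1) (hAv : ∀ n : ℕ, A * v * q ^ n ≠ 1) :
    ∃ K : ℝ, 0 < K ∧ ∀ N j m : ℕ,
      ‖veryWellPoisedTerm q (A * q ^ (N + 2 * j)) (u / q ^ j) (v / q ^ j) m‖ ≤
        K * (‖A * u * v / q‖ ^ m * ‖q‖ ^ (m * (m - 1) / 2)) ∧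
      ‖veryWellPoisedCertificate q (A * q ^ (N + 2 * j)) (u / q ^ j) (v / q ^ j) m‖ ≤
        K * (‖A * u * v / q‖ ^ m * ‖q‖ ^ (m * (m - 1) / 2)) := by
  obtain ⟨C1, hC1, h1⟩ := exists_norm_qShiftedFactorial_le hq ‖A‖
  obtain ⟨C2, hC2, h2⟩ := exists_norm_qShiftedFactorial_le hq ‖q / u‖
  obtain ⟨C3, hC3, h3⟩ := exists_norm_qShiftedFactorial_le hq ‖q / v‖
  obtain ⟨D1, hD1, k1⟩ := exists_norm_inv_qShiftedFactorial_le hq (self_mul_pow_ne_one hq)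
  obtain ⟨D2, hD2, k2⟩ := exists_norm_inv_qShiftedFactorial_shift_le hq hAu
  obtain ⟨D3, hD3, k3⟩ := exists_norm_inv_qShiftedFactorial_shift_le hq hAv
  have hqN (N : ℕ) : ‖q‖ ^ N ≤ 1 := pow_le_one₀ (norm_nonneg q) hq.le
  have hle (x : ℂ) (N : ℕ) : ‖x * q ^ N‖ ≤ ‖x‖ := by
    rw [norm_mul, norm_pow]; exact mul_le_of_le_one_right (norm_nonneg _) (hqN N)
  -- Here w is the only factor in which term and certificate differ, apart from sign.
  have key (N j m : ℕ) (w : ℂ) (hw : ‖w‖ ≤ 2 + ‖A‖) :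
      ‖w * qShiftedFactorial (A * q ^ (N + 2 * j)) q m * qShiftedFactorial (q / (u / q ^ j)) q m
      * qShiftedFactorial (q / (v / q ^ j)) q m
      * (-(A * q ^ (N + 2 * j) * (u / q ^ j) * (v / q ^ j) / q)) ^ m * q ^ (m * (m - 1) / 2)
    / (qShiftedFactorial q q m * qShiftedFactorial (A * q ^ (N + 2 * j) * (u / q ^ j)) q m
      * qShiftedFactorial (A * q ^ (N + 2 * j) * (v / q ^ j)) q m)‖ ≤
        (2 + ‖A‖) * C1 * C2 * C3 * D1 * D2 * D3 *
          (‖A * u * v / q‖ ^ m * ‖q‖ ^ (m * (m - 1) / 2)) := by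
    have hqj : q ^ j ≠ 0 := pow_ne_zero _ hq0
    have e1 (x : ℂ) : A * q ^ (N + 2 * j) * (x / q ^ j) = A * x * q ^ (N + j) := by
      field_simp; ring
    have e2 : -(A * u * q ^ (N + j) * (v / q ^ j) / q) = -(A * u * v / q) * q ^ N := by
      field_simp; ring
    have e3 (x : ℂ) : q / (x / q ^ j) = q / x * q ^ j := by rw [div_div_eq_mul_div]; ring
    have hp : ‖-(A * u * v / q) * q ^ N‖ ≤ ‖A * u * v / q‖ :=
      (hle _ N).trans_eq (norm_neg _)
    rw [div_eq_mul_inv, mul_inv, mul_inv, e1, e1, e2, e3, e3]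
    rw [norm_mul, norm_mul, norm_mul, norm_mul, norm_mul, norm_mul, norm_mul, norm_mul, norm_pow,
      norm_pow]
    calc _ ≤ (2 + ‖A‖) * C1 * C2 * C3 * ‖A * u * v / q‖ ^ m * ‖q‖ ^ (m * (m - 1) / 2) *
          (D1 * D2 * D3) := by
          gcongr ?_ * ?_ * ?_ * ?_ * ?_ ^ m * _ * (?_ * ?_ * ?_)
          · exact h1 _ (hle _ _) m
          · exact h2 _ (hle _ _) m
          · exact h3 _ (hle _ _) m
          · exact k1 m
          · exact k2 _ m
          · exact k3 _ m
      _ = _ := by ring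
  refine ⟨(2 + ‖A‖) * C1 * C2 * C3 * D1 * D2 * D3, by positivity, fun N j m => ⟨?_, ?_⟩⟩
  · refine key N j m _ ?_
    calc ‖1 - A * q ^ (N + 2 * j) * q ^ (2 * m)‖
        ≤ ‖(1 : ℂ)‖ + ‖A * q ^ (N + 2 * j) * q ^ (2 * m)‖ := norm_sub_le _ _
      _ ≤ 1 + ‖A‖ := by
        rw [norm_one]
        gcongr
        exact (hle _ _).trans (hle _ _)
      _ ≤ 2 + ‖A‖ := by linarith
  · rw [veryWellPoisedCertificate, neg_div, norm_neg]
    refine key N j m _ ?_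
    calc ‖1 - q ^ m‖ ≤ ‖(1 : ℂ)‖ + ‖q ^ m‖ := norm_sub_le _ _
      _ ≤ 1 + 1 := by
        rw [norm_one, norm_pow]
        gcongr
        exact hqN _
      _ ≤ 2 + ‖A‖ := by linarith [norm_nonneg A]

theorem summable_veryWellPoisedTerm (hq0 : q ≠ 0) (hq : ‖q‖ < 1) {A u v : ℂ}
    (hAu : ∀ n : ℕ, A * u * q ^ n ≠ 1) (hAv : ∀ n : ℕ, A * v * q ^ n ≠ 1) :
    Summable (veryWellPoisedTerm q A u v) := by
  obtain ⟨K, -, hK⟩ := exists_norm_veryWellPoised_le hq0 hq hAu hAv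
  refine .of_norm_bounded
    ((summable_pow_mul_pow_triangle (norm_nonneg q) hq ‖A * u * v / q‖).mul_left K) fun m => ?_
  simpa using (hK 0 0 m).1

/-- The certificate vanishes at m = 0 through its factor 1 - q^m and tends to 0 at infinity, so the
telescoped sum is zero. -/
theorem tsum_veryWellPoisedTerm_shift (hq0 : q ≠ 0) (hq : ‖q‖ < 1) {A u v : ℂ} (hu : u ≠ 0)
    (hv : v ≠ 0) (hAu : ∀ n : ℕ, A * u * q ^ n ≠ 1) (hAv : ∀ n : ℕ, A * v * q ^ n ≠ 1) :
    ∑' m, veryWellPoisedTerm q A u v m =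
      (1 - A) * (1 - A * u * v / q) / ((1 - A * u) * (1 - A * v)) *
        ∑' m, veryWellPoisedTerm q (A * q) u v m := by
  have hu' : ∀ n : ℕ, A * q * u * q ^ n ≠ 1 := fun n => by
    rw [show A * q * u * q ^ n = A * u * q ^ 1 * q ^ n by ring]
    exact mul_pow_ne_one_shift hAu 1 n
  have hv' : ∀ n : ℕ, A * q * v * q ^ n ≠ 1 := fun n => by
    rw [show A * q * v * q ^ n = A * v * q ^ 1 * q ^ n by ring]
    exact mul_pow_ne_one_shift hAv 1 n
  have hs := (summable_veryWellPoisedTerm hq0 hq hAu hAv).hasSum.sub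
    ((summable_veryWellPoisedTerm hq0 hq hu' hv').hasSum.mul_left
      ((1 - A) * (1 - A * u * v / q) / ((1 - A * u) * (1 - A * v))))
  have hlim : Tendsto (veryWellPoisedCertificate q A u v) atTop (𝓝 0) := by
    obtain ⟨K, -, hK⟩ := exists_norm_veryWellPoised_le hq0 hq hAu hAv
    refine squeeze_zero_norm (fun m => by simpa using (hK 0 0 m).2) ?_
    simpa using ((summable_pow_mul_pow_triangle (norm_nonneg q) hq
      ‖A * u * v / q‖).mul_left K).tendsto_atTop_zero
  refine sub_eq_zero.1 (tendsto_nhds_unique hs.tendsto_sum_nat (hlim.congr fun N => ?_))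
  simp only [veryWellPoisedTerm_sub hq0 hq hu hv hAu hAv, sum_range_sub]
  simp [veryWellPoisedCertificate]

theorem tsum_veryWellPoisedTerm_shift_pow (hq0 : q ≠ 0) (hq : ‖q‖ < 1) {A u v : ℂ} (hu : u ≠ 0)
    (hv : v ≠ 0) (hAu : ∀ n : ℕ, A * u * q ^ n ≠ 1) (hAv : ∀ n : ℕ, A * v * q ^ n ≠ 1) (N : ℕ) :
    ∑' m, veryWellPoisedTerm q A u v m =
      qShiftedFactorial A q N * qShiftedFactorial (A * u * v / q) q N /
        (qShiftedFactorial (A * u) q N * qShiftedFactorial (A * v) q N) *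
        ∑' m, veryWellPoisedTerm q (A * q ^ N) u v m := by
  induction N with
  | zero => simp [qShiftedFactorial_zero]
  | succ N ih =>
    have hu' : ∀ n : ℕ, A * q ^ N * u * q ^ n ≠ 1 := fun n => by
      rw [show A * q ^ N * u = A * u * q ^ N by ring]
      exact mul_pow_ne_one_shift hAu N n
    have hv' : ∀ n : ℕ, A * q ^ N * v * q ^ n ≠ 1 := fun n => by
      rw [show A * q ^ N * v = A * v * q ^ N by ring]
      exact mul_pow_ne_one_shift hAv N n
    rw [ih, tsum_veryWellPoisedTerm_shift hq0 hq hu hv hu' hv']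
    simp only [qShiftedFactorial_succ]
    rw [show A * q ^ N * u = A * u * q ^ N by ring, show A * q ^ N * v = A * v * q ^ N by ring,
      show A * u * q ^ N * v / q = A * u * v / q * q ^ N by ring,
      show A * q ^ (N + 1) = A * q ^ N * q by ring, ← mul_assoc, div_mul_div_comm]
    congr 2 <;> ring

/-- The limiting case of the nonterminating very-well-poised `₆φ₅` summation. -/
theorem hasSum_veryWellPoisedTerm (hq0 : q ≠ 0) (hq : ‖q‖ < 1) {A u v : ℂ} (hu : u ≠ 0)
    (hv : v ≠ 0) (hAu : ∀ n : ℕ, A * u * q ^ n ≠ 1) (hAv : ∀ n : ℕ, A * v * q ^ n ≠ 1) :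
    HasSum (veryWellPoisedTerm q A u v)
      (qShiftedFactorialInf A q * qShiftedFactorialInf (A * u * v / q) q /
        (qShiftedFactorialInf (A * u) q * qShiftedFactorialInf (A * v) q)) := by
  have hqN : Tendsto (fun N : ℕ => A * q ^ N) atTop (𝓝 0) := by
    simpa using (tendsto_pow_atTop_nhds_zero_of_norm_lt_one hq).const_mul A
  have hterm (m : ℕ) : Tendsto (fun N => veryWellPoisedTerm q (A * q ^ N) u v m) atTop
      (𝓝 (veryWellPoisedTerm q 0 u v m)) := by
    have hc : ContinuousAt (fun x => veryWellPoisedTerm q x u v m) 0 := by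
      unfold veryWellPoisedTerm qShiftedFactorial
      refine ContinuousAt.div (by fun_prop) (by fun_prop) ?_
      simpa [qShiftedFactorial] using qShiftedFactorial_ne_zero (self_mul_pow_ne_one hq) m
    exact hc.tendsto.comp hqN
  -- At A = 0 the m-th power kills every term with m > 0.
  have hzero : ∑' m, veryWellPoisedTerm q 0 u v m = 1 := by
    rw [tsum_eq_single 0 fun m hm => by simp [veryWellPoisedTerm, hm]]
    simp [veryWellPoisedTerm, qShiftedFactorial_zero]
  obtain ⟨K, -, hK⟩ := exists_norm_veryWellPoised_le hq0 hq hAu hAv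
  have hlim := tendsto_tsum_of_dominated_convergence
    ((summable_pow_mul_pow_triangle (norm_nonneg q) hq ‖A * u * v / q‖).mul_left K) hterm
    (.of_forall fun N m => by simpa using (hK N 0 m).1)
  rw [hzero] at hlim
  have hprod := ((tendsto_qShiftedFactorial A hq).mul
    (tendsto_qShiftedFactorial (A * u * v / q) hq)).div
    ((tendsto_qShiftedFactorial (A * u) hq).mul (tendsto_qShiftedFactorial (A * v) hq))
    (mul_ne_zero (qShiftedFactorialInf_ne_zero hq hAu) (qShiftedFactorialInf_ne_zero hq hAv))
  have h := (hprod.mul hlim).congr fun N =>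
    (tsum_veryWellPoisedTerm_shift_pow hq0 hq hu hv hAu hAv N).symm
  rw [mul_one] at h
  rw [← tendsto_nhds_unique tendsto_const_nhds h]
  exact (summable_veryWellPoisedTerm hq0 hq hAu hAv).hasSum

end VeryWellPoised

/-! ### The double series and its two orders of summation. -/

section Expansion

variable {q : ℂ}

/-- Balances the powers of q from the coefficient, from (q^{-n};q)_k and from (qz)^k. -/
theorem triangle_add (k m : ℕ) :
    (k + m) * (k + m - 1) / 2 + k * (k - 1) / 2 + k = m * (m - 1) / 2 + (k + m) * k := by
  induction k with
  | zero => simp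
  | succ k ih =>
    rw [show k + 1 + m = k + m + 1 by ring, Nat.triangle_succ, Nat.triangle_succ]
    linarith

theorem basicHypergeometricTerm_four_three (a₁ a₂ a₃ a₄ b₁ b₂ b₃ q x : ℂ) (k : ℕ) :
    basicHypergeometricTerm [a₁, a₂, a₃, a₄] [b₁, b₂, b₃] q x k =
      qShiftedFactorial a₁ q k * qShiftedFactorial a₂ q k * qShiftedFactorial a₃ q k
        * qShiftedFactorial a₄ q k
      / (qShiftedFactorial q q k * qShiftedFactorial b₁ q k * qShiftedFactorial b₂ q k
        * qShiftedFactorial b₃ q k) * x ^ k := by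
  simp [basicHypergeometricTerm, qShiftedFactorials, mul_assoc]

theorem exists_norm_basicHypergeometricTerm_le (hq : ‖q‖ < 1) (a₁ a₂ a₃ a₄ : ℂ) {c d h : ℂ}
    (hc : ∀ n : ℕ, c * q ^ n ≠ 1) (hd : ∀ n : ℕ, d * q ^ n ≠ 1) (hh : ∀ n : ℕ, h * q ^ n ≠ 1)
    (x : ℂ) :
    ∃ K : ℝ, 0 < K ∧ ∀ k : ℕ,
      ‖basicHypergeometricTerm [a₁, a₂, a₃, a₄] [c, d, h] q x k‖ ≤ K * ‖x‖ ^ k := by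
  obtain ⟨C1, hC1, h1⟩ := exists_norm_qShiftedFactorial_le hq ‖a₁‖
  obtain ⟨C2, hC2, h2⟩ := exists_norm_qShiftedFactorial_le hq ‖a₂‖
  obtain ⟨C3, hC3, h3⟩ := exists_norm_qShiftedFactorial_le hq ‖a₃‖
  obtain ⟨C4, hC4, h4⟩ := exists_norm_qShiftedFactorial_le hq ‖a₄‖
  obtain ⟨D1, hD1, k1⟩ := exists_norm_inv_qShiftedFactorial_le hq (self_mul_pow_ne_one hq)
  obtain ⟨D2, hD2, k2⟩ := exists_norm_inv_qShiftedFactorial_le hq hc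
  obtain ⟨D3, hD3, k3⟩ := exists_norm_inv_qShiftedFactorial_le hq hd
  obtain ⟨D4, hD4, k4⟩ := exists_norm_inv_qShiftedFactorial_le hq hh
  refine ⟨C1 * C2 * C3 * C4 * (D1 * D2 * D3 * D4), by positivity, fun k => ?_⟩
  rw [basicHypergeometricTerm_four_three, div_eq_mul_inv, mul_inv, mul_inv, mul_inv]
  simp only [norm_mul, norm_pow]
  gcongr ?_ * ?_ * ?_ * ?_ * (?_ * ?_ * ?_ * ?_) * _
  · exact h1 _ le_rfl k
  · exact h2 _ le_rfl k
  · exact h3 _ le_rfl k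
  · exact h4 _ le_rfl k
  · exact k1 k
  · exact k2 k
  · exact k3 k
  · exact k4 k

/-- The coefficients of the expansion in terminating `₄φ₃` series. -/
noncomputable def expansionCoeff (q α a b : ℂ) (n : ℕ) : ℂ :=
  (1 - α * q ^ (2 * n)) * qShiftedFactorials [α, q / a, q / b] q n
    * (-(α * a * b / q)) ^ n * q ^ (n * (n - 1) / 2)
    / ((1 - α) * qShiftedFactorials [q, α * a, α * b] q n)

theorem expansionCoeff_mul_term (hq0 : q ≠ 0) (hq : ‖q‖ < 1) {α a b : ℂ} (z β γ c d h : ℂ)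
    (k m : ℕ) :
    expansionCoeff q α a b (k + m) *
        basicHypergeometricTerm [q ^ (-((k + m : ℕ) : ℤ)), α * q ^ (k + m), β, γ] [c, d, h]
          q (q * z) k =
      qShiftedFactorial α q (2 * k) / ((1 - α) * qShiftedFactorial (α * a) q k
          * qShiftedFactorial (α * b) q k)
        * basicHypergeometricTerm [q / a, q / b, β, γ] [c, d, h] q (α * a * b * z / q) k
        * veryWellPoisedTerm q (α * q ^ (2 * k)) (a / q ^ k) (b / q ^ k) m := by
  have hqk : q ^ k ≠ 0 := pow_ne_zero _ hq0
  have hqkm : q ^ ((k + m) * k) ≠ 0 := pow_ne_zero _ hq0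
  have e1 (x : ℂ) : α * q ^ (2 * k) * (x / q ^ k) = α * x * q ^ k := by field_simp; ring
  have e2 : α * a * q ^ k * (b / q ^ k) = α * a * b := by field_simp
  have e3 (x : ℂ) : q / (x / q ^ k) = q / x * q ^ k := by rw [div_div_eq_mul_div]; ring
  have hterm : qShiftedFactorial (q ^ (-((k + m : ℕ) : ℤ))) q k =
      (-1) ^ k * q ^ (k * (k - 1) / 2) *
        (qShiftedFactorial q q (k + m) / qShiftedFactorial q q m) / q ^ ((k + m) * k) := by
    rw [eq_div_iff hqkm, qShiftedFactorial_neg_pow hq hq0]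
  have hα2 : qShiftedFactorial α q (k + m) * qShiftedFactorial (α * q ^ (k + m)) q k =
      qShiftedFactorial α q (2 * k) * qShiftedFactorial (α * q ^ (2 * k)) q m := by
    rw [← qShiftedFactorial_add, ← qShiftedFactorial_add]
    congr 1; ring
  have hpow : (-(α * a * b / q)) ^ (k + m) * q ^ ((k + m) * (k + m - 1) / 2) *
      ((-1) ^ k * q ^ (k * (k - 1) / 2) / q ^ ((k + m) * k)) * (q * z) ^ k =
      (-(α * a * b / q)) ^ m * q ^ (m * (m - 1) / 2) * (α * a * b * z / q) ^ k := by
    have h1 : (q ^ ((k + m) * (k + m - 1) / 2) * q ^ (k * (k - 1) / 2)) * q ^ k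
        / q ^ ((k + m) * k) = q ^ (m * (m - 1) / 2) := by
      rw [div_eq_iff hqkm, ← pow_add, ← pow_add, ← pow_add, triangle_add]
    rw [← h1, pow_add, show α * a * b * z / q = -(α * a * b / q) * (-1) * z by ring, mul_pow,
      mul_pow, mul_pow]
    ring
  rw [basicHypergeometricTerm_four_three, basicHypergeometricTerm_four_three, expansionCoeff,
    veryWellPoisedTerm, e1, e1, e2, e3, e3, hterm]
  simp only [qShiftedFactorials, List.map_cons, List.map_nil, List.prod_cons, List.prod_nil,
    mul_one]
  rw [qShiftedFactorial_add (q / a), qShiftedFactorial_add (q / b),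
    qShiftedFactorial_add (α * a), qShiftedFactorial_add (α * b),
    show α * q ^ (2 * (k + m)) = α * q ^ (2 * k) * q ^ (2 * m) by ring]
  have h1 := qShiftedFactorial_ne_zero (self_mul_pow_ne_one hq) (k + m)
  generalize qShiftedFactorial q q (k + m) = Q1 at *
  calc _ = (Q1 / Q1) * (1 - α * q ^ (2 * k) * q ^ (2 * m)) *
        (qShiftedFactorial α q (k + m) * qShiftedFactorial (α * q ^ (k + m)) q k) *
        ((-(α * a * b / q)) ^ (k + m) * q ^ ((k + m) * (k + m - 1) / 2) *
          ((-1) ^ k * q ^ (k * (k - 1) / 2) / q ^ ((k + m) * k)) * (q * z) ^ k) *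
        (qShiftedFactorial (q / a) q k * qShiftedFactorial (q / a * q ^ k) q m) *
        (qShiftedFactorial (q / b) q k * qShiftedFactorial (q / b * q ^ k) q m) *
        qShiftedFactorial β q k * qShiftedFactorial γ q k /
        ((1 - α) * qShiftedFactorial q q m *
          (qShiftedFactorial (α * a) q k * qShiftedFactorial (α * a * q ^ k) q m) *
          (qShiftedFactorial (α * b) q k * qShiftedFactorial (α * b * q ^ k) q m) *
          (qShiftedFactorial q q k * qShiftedFactorial c q k * qShiftedFactorial d q k
            * qShiftedFactorial h q k)) := by
        simp only [div_eq_mul_inv, mul_inv]; ring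
    _ = _ := by
        rw [hα2, hpow, div_self h1]
        simp only [div_eq_mul_inv, mul_inv]; ring

/-- The finite products in front complete the `₆φ₅` value to infinite products independent of k. -/
theorem hasSum_expansionCoeff_mul_term (hq0 : q ≠ 0) (hq : ‖q‖ < 1) {α a b : ℂ}
    (z β γ c d h : ℂ) (hα : α ≠ 1) (ha : a ≠ 0) (hb : b ≠ 0)
    (hαa : ∀ n : ℕ, α * a * q ^ n ≠ 1) (hαb : ∀ n : ℕ, α * b * q ^ n ≠ 1) (k : ℕ) :
    HasSum (fun m : ℕ => expansionCoeff q α a b (k + m) *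
        basicHypergeometricTerm [q ^ (-((k + m : ℕ) : ℤ)), α * q ^ (k + m), β, γ] [c, d, h]
          q (q * z) k)
      (qShiftedFactorialsInf [α * q, α * a * b / q] q / qShiftedFactorialsInf [α * a, α * b] q
        * basicHypergeometricTerm [q / a, q / b, β, γ] [c, d, h] q (α * a * b * z / q) k) := by
  simp only [expansionCoeff_mul_term hq0 hq z β γ c d h]
  have hα' : 1 - α ≠ 0 := sub_ne_zero.2 hα.symm
  have hqk : q ^ k ≠ 0 := pow_ne_zero _ hq0
  have e1 (x : ℂ) : α * q ^ (2 * k) * (x / q ^ k) = α * x * q ^ k := by field_simp; ring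
  have e2 : α * a * q ^ k * (b / q ^ k) = α * a * b := by field_simp
  have hsum := (hasSum_veryWellPoisedTerm hq0 hq (A := α * q ^ (2 * k)) (div_ne_zero ha hqk)
    (div_ne_zero hb hqk) (fun n => by rw [e1]; exact mul_pow_ne_one_shift hαa k n)
    (fun n => by rw [e1]; exact mul_pow_ne_one_shift hαb k n)).mul_left
    (qShiftedFactorial α q (2 * k) / ((1 - α) * qShiftedFactorial (α * a) q k
          * qShiftedFactorial (α * b) q k)
        * basicHypergeometricTerm [q / a, q / b, β, γ] [c, d, h] q (α * a * b * z / q) k)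
  convert hsum using 1
  · rfl
  have hinf : qShiftedFactorialInf α q = (1 - α) * qShiftedFactorialInf (α * q) q := by
    rw [qShiftedFactorialInf_eq_mul α hq 1, pow_one]
    simp [qShiftedFactorial]
  have hinf' : qShiftedFactorialInf (α * q) q =
      qShiftedFactorial α q (2 * k) * qShiftedFactorialInf (α * q ^ (2 * k)) q / (1 - α) := by
    rw [eq_div_iff hα', mul_comm, ← hinf, qShiftedFactorialInf_eq_mul α hq (2 * k)]
  simp only [qShiftedFactorialsInf, List.map_cons, List.map_nil, List.prod_cons, List.prod_nil,
    mul_one]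
  rw [e1, e1, e2, qShiftedFactorialInf_eq_mul (α * a) hq k,
    qShiftedFactorialInf_eq_mul (α * b) hq k, hinf']
  simp only [div_eq_mul_inv, mul_inv]
  ring

/-- The smallness condition is needed only for the geometric decay in k; the m-direction converges
for any αab/q. -/
theorem summable_expansionCoeff_mul_term (hq0 : q ≠ 0) (hq : ‖q‖ < 1) {α a b z c d h : ℂ}
    (β γ : ℂ)
    (hαa : ∀ n : ℕ, α * a * q ^ n ≠ 1) (hαb : ∀ n : ℕ, α * b * q ^ n ≠ 1)
    (hc : ∀ n : ℕ, c * q ^ n ≠ 1) (hd : ∀ n : ℕ, d * q ^ n ≠ 1) (hh : ∀ n : ℕ, h * q ^ n ≠ 1)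
    (hz : ‖α * a * b * z / q‖ < 1) :
    Summable fun p : ℕ × ℕ => expansionCoeff q α a b (p.1 + p.2) *
        basicHypergeometricTerm [q ^ (-((p.1 + p.2 : ℕ) : ℤ)), α * q ^ (p.1 + p.2), β, γ]
          [c, d, h] q (q * z) p.1 := by
  obtain ⟨C1, hC1, h1⟩ := exists_norm_qShiftedFactorial_le hq ‖α‖
  obtain ⟨D1, hD1, k1⟩ := exists_norm_inv_qShiftedFactorial_le hq hαa
  obtain ⟨D2, hD2, k2⟩ := exists_norm_inv_qShiftedFactorial_le hq hαb
  obtain ⟨K1, hK1, l1⟩ := exists_norm_basicHypergeometricTerm_le hq (q / a) (q / b) β γ hc hd hh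
    (α * a * b * z / q)
  obtain ⟨K2, hK2, l2⟩ := exists_norm_veryWellPoised_le hq0 hq hαa hαb
  refine .of_norm_bounded (((summable_geometric_of_lt_one (norm_nonneg _) hz).mul_of_nonneg
    (summable_pow_mul_pow_triangle (norm_nonneg q) hq ‖α * a * b / q‖)
    (fun _ => by positivity) (fun _ => by positivity)).mul_left
      (C1 * (‖(1 - α)⁻¹‖ * D1 * D2) * K1 * K2)) fun p => ?_
  rw [expansionCoeff_mul_term hq0 hq z β γ c d h, div_eq_mul_inv, mul_inv, mul_inv,
    norm_mul, norm_mul, norm_mul, norm_mul, norm_mul]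
  have hvwp := (l2 0 p.1 p.2).1
  rw [zero_add] at hvwp
  calc _ ≤ C1 * (‖(1 - α)⁻¹‖ * D1 * D2) * (K1 * ‖α * a * b * z / q‖ ^ p.1) *
        (K2 * (‖α * a * b / q‖ ^ p.2 * ‖q‖ ^ (p.2 * (p.2 - 1) / 2))) := by
        gcongr ?_ * (_ * ?_ * ?_) * ?_ * ?_
        · exact h1 _ le_rfl _
        · exact k1 _
        · exact k2 _
        · exact l1 _
    _ = _ := by ring

theorem qShiftedFactorial_neg_pow_eq_zero (hq0 : q ≠ 0) {n k : ℕ} (hnk : n < k) :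
    qShiftedFactorial (q ^ (-(n : ℤ))) q k = 0 :=
  prod_eq_zero (mem_range.2 hnk) (by
    rw [zpow_neg, zpow_natCast, inv_mul_cancel₀ (pow_ne_zero _ hq0), sub_self])

theorem basicHypergeometric_terminating (hq0 : q ≠ 0) (a₂ a₃ a₄ b₁ b₂ b₃ x : ℂ) (n : ℕ) :
    basicHypergeometric [q ^ (-(n : ℤ)), a₂, a₃, a₄] [b₁, b₂, b₃] q x =
      ∑ k ∈ range (n + 1),
        basicHypergeometricTerm [q ^ (-(n : ℤ)), a₂, a₃, a₄] [b₁, b₂, b₃] q x k := by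
  refine tsum_eq_sum fun k hk => ?_
  rw [basicHypergeometricTerm_four_three, qShiftedFactorial_neg_pow_eq_zero hq0 (by simpa using hk)]
  simp

theorem HasSum.sum_antidiagonal {f : ℕ × ℕ → ℂ} {s : ℂ} (hf : HasSum f s) :
    HasSum (fun n => ∑ p ∈ antidiagonal n, f p) s := by
  refine ((HasAntidiagonal.sigmaAntidiagonalEquivProd (A := ℕ)).hasSum_iff.2 hf).sigma fun n => ?_
  rw [← sum_coe_sort]
  exact hasSum_fintype _

end Expansion

theorem mainTheorem2 (q : ℝ) (hq0 : 0 < q) (hq1 : q < 1)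
    (α a b z β γ c d h : ℂ)
    (hα : α ≠ 1) (ha : a ≠ 0) (hb : b ≠ 0)
    (hαa : ∀ n : ℕ, α * a * (q : ℂ) ^ n ≠ 1) (hαb : ∀ n : ℕ, α * b * (q : ℂ) ^ n ≠ 1)
    (hc : ∀ n : ℕ, c * (q : ℂ) ^ n ≠ 1) (hd : ∀ n : ℕ, d * (q : ℂ) ^ n ≠ 1)
    (hh : ∀ n : ℕ, h * (q : ℂ) ^ n ≠ 1)
    (hz : ‖α * a * b * z / q‖ < 1) :
    Summable (basicHypergeometricTerm [q / a, q / b, β, γ] [c, d, h] q (α * a * b * z / q)) ∧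
    HasSum
      (fun n : ℕ =>
        (1 - α * (q : ℂ) ^ (2 * n)) * qShiftedFactorials [α, q / a, q / b] q n
            * (-(α * a * b / q)) ^ n * (q : ℂ) ^ (n * (n - 1) / 2)
          / ((1 - α) * qShiftedFactorials [(q : ℂ), α * a, α * b] q n)
          * basicHypergeometric [(q : ℂ) ^ (-(n : ℤ)), α * (q : ℂ) ^ n, β, γ] [c, d, h] q (q * z))
      (qShiftedFactorialsInf [α * q, α * a * b / q] q / qShiftedFactorialsInf [α * a, α * b] q
        * basicHypergeometric [q / a, q / b, β, γ] [c, d, h] q (α * a * b * z / q)) := by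
  have hq0' : (q : ℂ) ≠ 0 := by exact_mod_cast hq0.ne'
  have hq : ‖(q : ℂ)‖ < 1 := by rwa [Complex.norm_real, Real.norm_of_nonneg hq0.le]
  have hsum : Summable
      (basicHypergeometricTerm [q / a, q / b, β, γ] [c, d, h] q (α * a * b * z / q)) := by
    obtain ⟨K, -, hK⟩ := exists_norm_basicHypergeometricTerm_le hq (q / a) (q / b) β γ hc hd hh
      (α * a * b * z / q)
    exact .of_norm_bounded ((summable_geometric_of_lt_one (norm_nonneg _) hz).mul_left K) hK
  refine ⟨hsum, ?_⟩
  have hdouble := (summable_expansionCoeff_mul_term hq0' hq β γ hαa hαb hc hd hh hz).hasSum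
  have hrow := hdouble.prod_fiberwise
    (hasSum_expansionCoeff_mul_term hq0' hq z β γ c d h hα ha hb hαa hαb)
  -- Row sums identify the total; the antidiagonals k + m = n then give the right-hand series, whose
  -- terminating sums have exactly 0 ≤ k ≤ n.
  rw [hrow.unique (hsum.hasSum.mul_left _)] at hdouble
  refine hdouble.sum_antidiagonal.congr_fun fun n => ?_
  rw [basicHypergeometric_terminating hq0', mul_sum,
    Finset.Nat.sum_antidiagonal_eq_sum_range_succ_mk]
  refine sum_congr rfl fun k hk => ?_
  have hkn : k + (n - k) = n := Nat.add_sub_cancel' (Nat.lt_succ_iff.1 (mem_range.1 hk))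
  simp only [hkn, expansionCoeff]
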